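/- Let $\mathbb R^4_1$ be $\mathbb R^4$ with the Lorentz metric $\langle x,y\rangle=-x_0y_0+x_1y_1+x_2y_2+x_3y_3$, let $S^3_1=\{x\in\mathbb R^4_1:\langle x,x\rangle=1\}$ be de Sitter $3$-space, and identify $\mathbb R^4_1$ with the $2\times2$ Hermitian matrices by $$x\longleftrightarrow\begin{pmatrix}x_0+x_3 & x_1+ix_2\\ x_1-ix_2 & x_0-x_3\end{pmatrix}.$$ Let $M^2$ be a connected smooth $2$-manifold, not assumed orientable. A $C^\infty$ map $f:M^2\to S^3_1$ is called a CMC-1 face if the set of points at which $f$ is an immersion is open and dense in $M^2$, and every $p\in M^2$ has an open neighbourhood $U$ with a complex structure compatible with its smooth structure and a holomorphic immersion $F:U\to SL(2,\mathbb C)$ that is null, i.e. $\det(dF/dz)=0$ for every local complex coordinate $z$, such that $f=Fe_3F^*$ on $U$, where $e_3=\mathrm{diag}(1,-1)$ and $F^*={}^t\overline F$. Theorem. If there is a CMC-1 face $f:M^2\to S^3_1$, then $M^2$ is orientable. -/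

import Mathlib

open scoped Manifold ContDiff Matrix

/-- The Lorentz metric `-x₀y₀ + x₁y₁ + x₂y₂ + x₃y₃` of Lorentz-Minkowski 4-space. -/
def lorentzInner (x y : Fin 4 → ℝ) : ℝ :=
  -(x 0 * y 0) + x 1 * y 1 + x 2 * y 2 + x 3 * y 3

/-- De Sitter 3-space `{x : ⟨x, x⟩ = 1}` in Lorentz-Minkowski 4-space. -/
def deSitter : Set (Fin 4 → ℝ) := {x | lorentzInner x x = 1}

/-- The identification `x ↦ x₀e₀ + x₁e₁ + x₂e₂ + x₃e₃` of Lorentz-Minkowski 4-space with the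
Hermitian 2×2 matrices. -/
def hermMatrix (x : Fin 4 → ℝ) : Matrix (Fin 2) (Fin 2) ℂ :=
  !![(x 0 : ℂ) + x 3, (x 1 : ℂ) + Complex.I * x 2;
     (x 1 : ℂ) - Complex.I * x 2, (x 0 : ℂ) - x 3]

/-- The matrix `e₃ = diag(1, -1)`. -/
def matE3 : Matrix (Fin 2) (Fin 2) ℂ := !![1, 0; 0, -1]

section Surface

variable {M : Type*} [TopologicalSpace M] [ChartedSpace (EuclideanSpace ℝ (Fin 2)) M]

/-- `z` is a complex-valued local coordinate of the smooth surface `M`: a diffeomorphism, for the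
smooth structure of `M`, from the open set `z.source` onto the open set `z.target` of `ℂ`. It makes
`z.source` into a Riemann surface whose complex structure is compatible with the smooth
structure. -/
def IsComplexCoordinate (z : OpenPartialHomeomorph M ℂ) : Prop :=
  ContMDiffOn (𝓡 2) 𝓘(ℝ, ℂ) ∞ z z.source ∧ ContMDiffOn 𝓘(ℝ, ℂ) (𝓡 2) ∞ z.symm z.target

/-- The entrywise derivative `dF/dz` with respect to the complex coordinate `z`, at the point with
coordinate `w`. -/
noncomputable def coordDeriv (z : OpenPartialHomeomorph M ℂ)
    (F : M → Matrix.SpecialLinearGroup (Fin 2) ℂ) (w : ℂ) : Matrix (Fin 2) (Fin 2) ℂ :=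
  Matrix.of fun i j => deriv (fun v : ℂ => (F (z.symm v) : Matrix (Fin 2) (Fin 2) ℂ) i j) w

/-- On the domain of the complex coordinate `z`, the map `F` into `SL(2, ℂ)` is holomorphic, null
(`det (dF/dz) = 0`) and an immersion (`dF/dz ≠ 0`). Values of `F` off that domain are irrelevant. -/
structure IsNullHolomorphicImmersion (z : OpenPartialHomeomorph M ℂ)
    (F : M → Matrix.SpecialLinearGroup (Fin 2) ℂ) : Prop where
  holomorphic : ∀ i j : Fin 2,
    DifferentiableOn ℂ (fun w : ℂ => (F (z.symm w) : Matrix (Fin 2) (Fin 2) ℂ) i j) z.target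
  null : ∀ w ∈ z.target, (coordDeriv z F w).det = 0
  immersion : ∀ w ∈ z.target, coordDeriv z F w ≠ 0

/-- The regular set of `f`: the points where `f` is an immersion. -/
def regularSet (f : M → Fin 4 → ℝ) : Set M :=
  {p | Function.Injective (mfderiv (𝓡 2) 𝓘(ℝ, Fin 4 → ℝ) f p)}

/-- CMC-1 faces. The surface `M` carries no complex structure in advance: near each point the null
holomorphic immersion is holomorphic for some complex structure on a neighbourhood. After shrinking
the neighbourhood, such a complex structure is given by a single complex coordinate `z`. -/
structure IsCMCOneFace (f : M → Fin 4 → ℝ) : Prop where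
  smooth : ContMDiff (𝓡 2) 𝓘(ℝ, Fin 4 → ℝ) ∞ f
  mem_deSitter : ∀ p, f p ∈ deSitter
  isOpen_regularSet : IsOpen (regularSet f)
  dense_regularSet : Dense (regularSet f)
  exists_lift : ∀ p : M, ∃ z : OpenPartialHomeomorph M ℂ, p ∈ z.source ∧ IsComplexCoordinate z ∧
    ∃ F : M → Matrix.SpecialLinearGroup (Fin 2) ℂ, IsNullHolomorphicImmersion z F ∧
      ∀ q ∈ z.source, hermMatrix (f q) =
        (F q : Matrix (Fin 2) (Fin 2) ℂ) * matE3 * (F q : Matrix (Fin 2) (Fin 2) ℂ)ᴴ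

variable (M) in
/-- The smooth surface `M` is orientable: it is covered by charts of its smooth structure whose
transition maps have positive Jacobian determinant. -/
def IsOrientableSurface : Prop :=
  ∃ A : Set (OpenPartialHomeomorph M (EuclideanSpace ℝ (Fin 2))),
    A ⊆ IsManifold.maximalAtlas (𝓡 2) ∞ M ∧
    (∀ p : M, ∃ φ ∈ A, p ∈ φ.source) ∧
    ∀ φ ∈ A, ∀ ψ ∈ A, ∀ x ∈ (φ.symm.trans ψ).source,
      0 < (fderiv ℝ (φ.symm.trans ψ) x).det

end Surface

/-! All complex coordinates carrying a null lift form an oriented atlas; the point is that a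
transition `T` between two of them, with lifts `K` and `F`, has positive Jacobian.

If not, the Jacobian is negative on an open set, which meets the dense regular set. Regard `f` as a
Hermitian matrix and put `C = F⁻¹F'`, which is nilpotent since `det F = 1` and `det F' = 0`. At
regular points the off-diagonal entries of `C` differ in modulus (`normSq_ne_of_regular`).

(1) The `∂`-derivative of `K e₃ K* = (F e₃ F*) ∘ T` is singular on the left because `K` is null. On
the right this forces `∂T = 0` or `∂̄T = 0` (`mul_eq_zero_of_det_eq_zero`). So `T` is
antiholomorphic.

(2) A holomorphic lift gives `f_{zz̄} = f_z f⁻¹ f_z̄`, an antiholomorphic one `f_{zz̄} = f_z̄ f⁻¹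
f_z` (`sesq_self_eq`). Both hold, for `K` and for `F ∘ T`, and in terms of `C` their equality says
that the off-diagonal moduli agree (`normSq_eq_of_antiholomorphic`), a contradiction. -/

open ComplexConjugate

/-! ### Wirtinger calculus -/

/-- The real-linear map `d ↦ α d + β d̄` of `ℂ`. -/
noncomputable def wirtingerMap (α β : ℂ) : ℂ →L[ℝ] ℂ :=
  α • (ContinuousLinearMap.id ℝ ℂ) + β • (Complex.conjCLE : ℂ →L[ℝ] ℂ)

@[simp] lemma wirtingerMap_apply (α β d : ℂ) :
    wirtingerMap α β d = α * d + β * conj d := by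
  simp [wirtingerMap]

lemma wirtingerMap_injective {α β γ δ : ℂ} (h : wirtingerMap α β = wirtingerMap γ δ) :
    α = γ ∧ β = δ := by
  have h1 := congrArg (fun L : ℂ →L[ℝ] ℂ => L 1) h
  have h2 := congrArg (fun L : ℂ →L[ℝ] ℂ => L Complex.I) h
  simp only [wirtingerMap_apply, map_one, mul_one, Complex.conj_I] at h1 h2
  have h3 : α - β = γ - δ := by
    apply mul_left_cancel₀ Complex.I_ne_zero
    linear_combination h2
  constructor
  · linear_combination (h1 + h3) / 2
  · linear_combination (h1 - h3) / 2

lemma exists_eq_wirtingerMap (L : ℂ →L[ℝ] ℂ) : ∃ α β, L = wirtingerMap α β := by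
  refine ⟨(L 1 - Complex.I * L Complex.I) / 2, (L 1 + Complex.I * L Complex.I) / 2, ?_⟩
  ext d
  have hd : L d = d.re * L 1 + d.im * L Complex.I := by
    conv_lhs => rw [show d = d.re • (1 : ℂ) + d.im • Complex.I by simp [Complex.re_add_im]]
    rw [map_add, map_smul, map_smul]
    simp
  have hI := Complex.I_mul_I
  rw [hd, wirtingerMap_apply]
  conv_rhs => rw [← Complex.re_add_im d]
  simp only [map_add, map_mul, Complex.conj_I, Complex.conj_ofReal]
  linear_combination ((d.im : ℂ) * L Complex.I) * hI

lemma det_wirtingerMap (α β : ℂ) :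
    (wirtingerMap α β).det = Complex.normSq α - Complex.normSq β := by
  rw [ContinuousLinearMap.det, ← LinearMap.det_toMatrix Complex.basisOneI, Matrix.det_fin_two]
  simp [LinearMap.toMatrix_apply, Complex.normSq_apply]
  ring

/-- `φ` is real-differentiable at `v` with Wirtinger derivatives `∂φ = α` and `∂̄φ = β`. -/
def HasWirtingerAt (φ : ℂ → ℂ) (α β v : ℂ) : Prop :=
  HasFDerivAt φ (wirtingerMap α β) v

namespace HasWirtingerAt

variable {φ ψ : ℂ → ℂ} {α β γ δ v : ℂ}

lemma of_hasDerivAt (h : HasDerivAt φ α v) : HasWirtingerAt φ α 0 v := by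
  have := h.hasFDerivAt.restrictScalars ℝ
  refine this.congr_fderiv ?_
  ext d
  simp [mul_comm]

lemma hasDerivAt (h : HasWirtingerAt φ α 0 v) : HasDerivAt φ α v := by
  refine hasFDerivAt_of_restrictScalars ℝ (f' := (ContinuousLinearMap.toSpanSingleton ℂ α)) h ?_
  ext d
  simp [mul_comm]

lemma star (h : HasWirtingerAt φ α β v) :
    HasWirtingerAt (fun x => starRingEnd ℂ (φ x)) (starRingEnd ℂ β) (starRingEnd ℂ α) v := by
  have := (Complex.conjCLE : ℂ →L[ℝ] ℂ).hasFDerivAt.comp v h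
  refine this.congr_fderiv ?_
  ext d
  simp [add_comm]

lemma mul (h : HasWirtingerAt φ α β v) (k : HasWirtingerAt ψ γ δ v) :
    HasWirtingerAt (fun x => φ x * ψ x) (α * ψ v + φ v * γ) (β * ψ v + φ v * δ) v := by
  refine (HasFDerivAt.mul h k).congr_fderiv ?_
  ext d
  simp
  ring

lemma sub (h : HasWirtingerAt φ α β v) (k : HasWirtingerAt ψ γ δ v) :
    HasWirtingerAt (fun x => φ x - ψ x) (α - γ) (β - δ) v := by
  refine (HasFDerivAt.sub h k).congr_fderiv ?_
  ext d
  simp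
  ring

lemma comp {T : ℂ → ℂ} (h : HasWirtingerAt φ α β (T v)) (k : HasWirtingerAt T γ δ v) :
    HasWirtingerAt (fun x => φ (T x)) (α * γ + β * starRingEnd ℂ δ)
      (α * δ + β * starRingEnd ℂ γ) v := by
  refine (HasFDerivAt.comp v h k).congr_fderiv ?_
  ext d
  simp
  ring

lemma unique (h : HasWirtingerAt φ α β v) (k : HasWirtingerAt φ γ δ v) : α = γ ∧ β = δ :=
  wirtingerMap_injective (HasFDerivAt.unique h k)

lemma congr_of_eventuallyEq (h : HasWirtingerAt φ α β v)
    (e : ψ =ᶠ[nhds v] φ) : HasWirtingerAt ψ α β v :=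
  HasFDerivAt.congr_of_eventuallyEq h e

end HasWirtingerAt

lemma mul_matE3_mul_conjTranspose_apply (P Q : Matrix (Fin 2) (Fin 2) ℂ) (i j : Fin 2) :
    (P * matE3 * Qᴴ) i j = P i 0 * conj (Q j 0) - P i 1 * conj (Q j 1) := by
  simp [matE3, Matrix.mul_apply, Fin.sum_univ_two]
  ring

/-- The product rule for the sesquilinear expression `P e₃ Q*`. -/
lemma HasWirtingerAt.matE3 {P Q : ℂ → Matrix (Fin 2) (Fin 2) ℂ}
    {P₁ P₂ Q₁ Q₂ : Matrix (Fin 2) (Fin 2) ℂ} {v : ℂ}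
    (hP : ∀ i j, HasWirtingerAt (fun x => P x i j) (P₁ i j) (P₂ i j) v)
    (hQ : ∀ i j, HasWirtingerAt (fun x => Q x i j) (Q₁ i j) (Q₂ i j) v) (i j : Fin 2) :
    HasWirtingerAt (fun x => (P x * _root_.matE3 * (Q x)ᴴ) i j)
      ((P₁ * _root_.matE3 * (Q v)ᴴ + P v * _root_.matE3 * Q₂ᴴ) i j)
      ((P₂ * _root_.matE3 * (Q v)ᴴ + P v * _root_.matE3 * Q₁ᴴ) i j) v := by
  simp only [mul_matE3_mul_conjTranspose_apply, Matrix.add_apply]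
  have := ((hP i 0).mul (hQ j 0).star).sub ((hP i 1).mul (hQ j 1).star)
  convert this using 1 <;> ring

/-- The entrywise derivative of a matrix-valued function. -/
noncomputable def entryDeriv (K : ℂ → Matrix (Fin 2) (Fin 2) ℂ) (v : ℂ) :
    Matrix (Fin 2) (Fin 2) ℂ :=
  Matrix.of fun i j => deriv (fun x => K x i j) v

/-- Jacobi's formula: the trace is the derivative of the constant `det F`. -/
lemma trace_adjugate_mul_entryDeriv {F : ℂ → Matrix (Fin 2) (Fin 2) ℂ} {v : ℂ}
    (hF : ∀ i j, DifferentiableAt ℂ (fun x => F x i j) v) (hdet : ∀ᶠ x in nhds v, (F x).det = 1) :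
    ((F v).adjugate * entryDeriv F v).trace = 0 := by
  have h := (((hF 0 0).hasDerivAt.mul (hF 1 1).hasDerivAt).sub
    ((hF 0 1).hasDerivAt.mul (hF 1 0).hasDerivAt))
  have h' := h.congr_of_eventuallyEq (f₁ := fun _ : ℂ => (1 : ℂ)) (by
    filter_upwards [hdet] with x hx
    rw [← hx, Matrix.det_fin_two]
    rfl)
  have h0 := h'.unique (hasDerivAt_const v (1 : ℂ))
  simp only [Matrix.trace_fin_two, Matrix.adjugate_fin_two, Matrix.mul_apply, Fin.sum_univ_two,
    entryDeriv, Matrix.of_apply, Matrix.cons_val', Matrix.cons_val_zero, Matrix.cons_val_one,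
    Matrix.cons_val_fin_one]
  linear_combination h0

/-! ### Algebra of the nilpotent matrix `C = F⁻¹F'` -/

section Algebra

variable {C : Matrix (Fin 2) (Fin 2) ℂ}

lemma conjTranspose_matE3 : matE3ᴴ = matE3 := by
  ext i j; fin_cases i <;> fin_cases j <;> simp [matE3]

lemma matE3_mul_self : matE3 * matE3 = 1 := by
  ext i j; fin_cases i <;> fin_cases j <;> simp [matE3]

/-- If `d ↦ d C e₃ + d̄ (C e₃)*` is injective for a nilpotent `C`, then the off-diagonal
entries of `C` have different absolute values. -/
lemma normSq_ne_of_regular (htr : C 1 1 = -C 0 0) (hdet : C.det = 0)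
    (hreg : ∀ d : ℂ, d • (C * matE3) + conj d • (C * matE3)ᴴ = 0 → d = 0) :
    Complex.normSq (C 0 1) ≠ Complex.normSq (C 1 0) := by
  intro h
  rw [Matrix.det_fin_two, htr] at hdet
  have hC : C * matE3 = !![C 0 0, -C 0 1; C 1 0, C 0 0] := by
    ext i j; fin_cases i <;> fin_cases j <;> simp [matE3, Matrix.mul_apply, htr]
  generalize C 0 0 = p at *
  generalize C 0 1 = q at *
  generalize C 1 0 = r at *
  have hc : q * conj q = r * conj r := by rw [Complex.mul_conj, Complex.mul_conj, h]
  have hz : p * p = -(q * r) := by linear_combination -hdet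
  have hn : Complex.normSq p * Complex.normSq p = Complex.normSq r * Complex.normSq r := by
    rw [← Complex.normSq_mul, hz, Complex.normSq_neg, Complex.normSq_mul, h]
  have hn' : Complex.normSq p = Complex.normSq r :=
    (mul_self_inj (Complex.normSq_nonneg _) (Complex.normSq_nonneg _)).1 hn
  have hp : p * conj p = r * conj r := by rw [Complex.mul_conj, Complex.mul_conj, hn']
  rcases eq_or_ne p 0 with rfl | hp0
  · have hr : r = 0 := by simpa using hn'.symm
    have hq : q = 0 := by simpa [hr] using h
    subst hr hq
    exact one_ne_zero (hreg 1 (by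
      rw [hC]; ext i j; fin_cases i <;> fin_cases j <;> simp))
  · have hk : q * conj p + p * conj r = 0 := by
      apply mul_left_cancel₀ hp0
      linear_combination q * hp + hz * conj r
    have hk' : conj q * p + conj p * r = 0 := by
      simpa using congrArg conj hk
    -- This `d` makes `d p` purely imaginary, which kills the diagonal; `hk` kills the off-diagonal
    -- entries.
    have := hreg (Complex.I * conj p) (by
      rw [hC]
      ext i j
      fin_cases i <;> fin_cases j <;> simp
      · ring
      · linear_combination (-Complex.I) * hk
      · linear_combination Complex.I * hk'
      · ring)
    rcases mul_eq_zero.1 this with h0 | h0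
    · exact Complex.I_ne_zero h0
    · exact hp0 (by simpa using h0)

/-- Write `p`, `q`, `r` for the entries `00`, `01`, `10` of `C`. Nilpotency, `p² = -qr`, removes the
`α²` and `γ²` terms of the determinant and leaves `αγ(2|p|² - |q|² - |r|²) = -αγ(|q| - |r|)²`. -/
lemma mul_eq_zero_of_det_eq_zero (htr : C 1 1 = -C 0 0) (hdet : C.det = 0)
    (hne : Complex.normSq (C 0 1) ≠ Complex.normSq (C 1 0)) {α γ : ℂ}
    (h : (α • (C * matE3) + γ • (C * matE3)ᴴ).det = 0) : α = 0 ∨ γ = 0 := by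
  rw [Matrix.det_fin_two, htr] at hdet
  have hC : C * matE3 = !![C 0 0, -C 0 1; C 1 0, C 0 0] := by
    ext i j; fin_cases i <;> fin_cases j <;> simp [matE3, Matrix.mul_apply, htr]
  rw [hC] at h
  generalize C 0 0 = p at *
  generalize C 0 1 = q at *
  generalize C 1 0 = r at *
  have hz : p * p = -(q * r) := by linear_combination -hdet
  have hz' : conj p * conj p = -(conj q * conj r) := by simpa using congrArg conj hz
  have hn : Complex.normSq p * Complex.normSq p = Complex.normSq q * Complex.normSq r := by
    rw [← Complex.normSq_mul, hz, Complex.normSq_neg, Complex.normSq_mul]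
  have hm : (α * γ) * (2 * (p * conj p) - q * conj q - r * conj r) = 0 := by
    simp [Matrix.det_fin_two] at h
    linear_combination h - α ^ 2 * hz - γ ^ 2 * hz'
  rcases mul_eq_zero.1 hm with h0 | h0
  · exact mul_eq_zero.1 h0
  · exfalso
    simp only [Complex.mul_conj] at h0
    have h1 : 2 * Complex.normSq p = Complex.normSq q + Complex.normSq r := by
      have : 2 * Complex.normSq p - Complex.normSq q - Complex.normSq r = 0 := by exact_mod_cast h0
      linarith
    apply hne
    -- Equality case of AM-GM for `|q|²` and `|r|²`, whose geometric mean is `|p|²`.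
    have : (Complex.normSq q - Complex.normSq r) ^ 2 = 0 := by
      linear_combination 4 * hn - (2 * Complex.normSq p + Complex.normSq q + Complex.normSq r) * h1
    exact sub_eq_zero.1 (pow_eq_zero_iff two_ne_zero |>.1 this)

/-- The `(0,0)` entries are `|C₀₀|² - |C₀₁|²` and `|C₀₀|² - |C₁₀|²`. -/
lemma normSq_eq_of_mul_eq
    (h : C * matE3 * Cᴴ = (C * matE3)ᴴ * matE3 * (C * matE3)) :
    Complex.normSq (C 0 1) = Complex.normSq (C 1 0) := by
  have h00 := congrFun (congrFun h 0) 0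
  simp [Matrix.mul_apply, matE3, Fin.sum_univ_two] at h00
  have : C 0 1 * conj (C 0 1) = C 1 0 * conj (C 1 0) := by linear_combination -h00
  simp only [Complex.mul_conj] at this
  exact_mod_cast this

end Algebra

/-! ### Differentiating the identity between two lifts -/

/-- In the chain rule for `K e₃ K* = (F e₃ F*) ∘ T`, the derivative of the right-hand side. -/
lemma wirtinger_chain {K F : ℂ → Matrix (Fin 2) (Fin 2) ℂ} {T : ℂ → ℂ} {α β v : ℂ}
    (hK : ∀ i j, DifferentiableAt ℂ (fun x => K x i j) v)
    (hF : ∀ i j, DifferentiableAt ℂ (fun x => F x i j) (T v))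
    (hT : HasWirtingerAt T α β v)
    (heq : ∀ᶠ x in nhds v, K x * matE3 * (K x)ᴴ = F (T x) * matE3 * (F (T x))ᴴ) :
    entryDeriv K v * matE3 * (K v)ᴴ =
      α • (entryDeriv F (T v) * matE3 * (F (T v))ᴴ)
        + conj β • (entryDeriv F (T v) * matE3 * (F (T v))ᴴ)ᴴ := by
  have hK' : ∀ i j, HasWirtingerAt (fun x => K x i j) (entryDeriv K v i j)
      ((0 : Matrix (Fin 2) (Fin 2) ℂ) i j) v :=
    fun i j => HasWirtingerAt.of_hasDerivAt (hK i j).hasDerivAt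
  have hF' : ∀ i j, HasWirtingerAt (fun x => F x i j) (entryDeriv F (T v) i j)
      ((0 : Matrix (Fin 2) (Fin 2) ℂ) i j) (T v) :=
    fun i j => HasWirtingerAt.of_hasDerivAt (hF i j).hasDerivAt
  ext i j
  have h1 := HasWirtingerAt.matE3 hK' hK' i j
  have h2 := (HasWirtingerAt.matE3 hF' hF' i j).comp hT
  have h3 := h1.congr_of_eventuallyEq
    (ψ := fun x => (F (T x) * matE3 * (F (T x))ᴴ) i j) (by
      filter_upwards [heq] with x hx
      rw [hx])
  have h4 := (h3.unique h2).1
  simp only [Matrix.conjTranspose_zero, mul_zero, add_zero, Matrix.zero_mul, zero_add] at h4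
  rw [h4]
  simp only [Matrix.conjTranspose_mul, Matrix.conjTranspose_conjTranspose, conjTranspose_matE3,
    Matrix.add_apply, Matrix.smul_apply, smul_eq_mul, Matrix.mul_assoc]
  ring

/-- If `K e₃ K* = L e₃ L*` with `K` holomorphic and `L` antiholomorphic near a point, then the
products `∂K e₃ ∂K*` and `∂̄L e₃ ∂̄L*` agree there, and `∂K e₃ K* = L e₃ ∂̄L*`. -/
lemma matE3_eq_of_antiholomorphic {K N : ℂ → Matrix (Fin 2) (Fin 2) ℂ} {U : Set ℂ}
    (hU : IsOpen U)
    (hK : ∀ i j, DifferentiableOn ℂ (fun x => K x i j) U)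
    (hN : ∀ i j, DifferentiableOn ℂ (fun x => N x i j) U)
    (heq : ∀ x ∈ U, K x * matE3 * (K x)ᴴ = (N x).map conj * matE3 * ((N x).map conj)ᴴ) :
    (∀ x ∈ U, entryDeriv K x * matE3 * (K x)ᴴ =
      (N x).map conj * matE3 * ((entryDeriv N x).map conj)ᴴ) ∧
    ∀ x ∈ U, entryDeriv K x * matE3 * (entryDeriv K x)ᴴ =
      (entryDeriv N x).map conj * matE3 * ((entryDeriv N x).map conj)ᴴ := by
  have hK' : ∀ x ∈ U, ∀ i j, HasWirtingerAt (fun x => K x i j) (entryDeriv K x i j)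
      ((0 : Matrix (Fin 2) (Fin 2) ℂ) i j) x := fun x hx i j =>
    HasWirtingerAt.of_hasDerivAt ((hK i j).differentiableAt (hU.mem_nhds hx)).hasDerivAt
  have hN' : ∀ x ∈ U, ∀ i j, HasWirtingerAt (fun x => (N x).map conj i j)
      ((0 : Matrix (Fin 2) (Fin 2) ℂ) i j) ((entryDeriv N x).map conj i j) x := fun x hx i j => by
    simpa [entryDeriv] using (HasWirtingerAt.of_hasDerivAt
      ((hN i j).differentiableAt (hU.mem_nhds hx)).hasDerivAt).star
  have hK'' : ∀ x ∈ U, ∀ i j, HasWirtingerAt (fun x => entryDeriv K x i j)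
      (entryDeriv (entryDeriv K) x i j) ((0 : Matrix (Fin 2) (Fin 2) ℂ) i j) x := fun x hx i j =>
    HasWirtingerAt.of_hasDerivAt (((hK i j).deriv hU).differentiableAt (hU.mem_nhds hx)).hasDerivAt
  have hN'' : ∀ x ∈ U, ∀ i j, HasWirtingerAt (fun x => (entryDeriv N x).map conj i j)
      ((0 : Matrix (Fin 2) (Fin 2) ℂ) i j) ((entryDeriv (entryDeriv N) x).map conj i j) x :=
    fun x hx i j => by
      simpa [entryDeriv] using (HasWirtingerAt.of_hasDerivAt
        (((hN i j).deriv hU).differentiableAt (hU.mem_nhds hx)).hasDerivAt).star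
  have first : ∀ x ∈ U, entryDeriv K x * matE3 * (K x)ᴴ =
      (N x).map conj * matE3 * ((entryDeriv N x).map conj)ᴴ := fun x hx => by
    ext i j
    have h1 := HasWirtingerAt.matE3 (hK' x hx) (hK' x hx) i j
    have h2 := HasWirtingerAt.matE3 (hN' x hx) (hN' x hx) i j
    have h3 := h1.congr_of_eventuallyEq
      (ψ := fun x => ((N x).map conj * matE3 * ((N x).map conj)ᴴ) i j) (by
        filter_upwards [hU.mem_nhds hx] with y hy
        rw [heq y hy])
    simpa using (h3.unique h2).1
  refine ⟨first, fun x hx => ?_⟩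
  -- Apply `∂̄` to `first`: on the left it reaches only `K*`, on the right only the conjugated `N`.
  ext i j
  have h1 := HasWirtingerAt.matE3 (hK'' x hx) (hK' x hx) i j
  have h2 := HasWirtingerAt.matE3 (hN' x hx) (hN'' x hx) i j
  have h3 := h1.congr_of_eventuallyEq
    (ψ := fun x => ((N x).map conj * matE3 * ((entryDeriv N x).map conj)ᴴ) i j) (by
      filter_upwards [hU.mem_nhds hx] with y hy
      rw [first y hy])
  simpa using (h3.unique h2).2

/-! ### Transport between `f` and `C` by `Z ↦ F Z F*` -/

section Algebra

variable {F B K A : Matrix (Fin 2) (Fin 2) ℂ}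

lemma mul_adjugate_mul_of_det_eq_one (hF : F.det = 1) : F * (F.adjugate * B) = B := by
  rw [← Matrix.mul_assoc, Matrix.mul_adjugate, hF, one_smul, Matrix.one_mul]

lemma sesq_eq_conj (hF : F.det = 1) :
    B * matE3 * Fᴴ = F * (F.adjugate * B * matE3) * Fᴴ := by
  rw [← Matrix.mul_assoc, mul_adjugate_mul_of_det_eq_one hF]

lemma apply_one_one_of_trace (h : (F.adjugate * B).trace = 0) :
    (F.adjugate * B) 1 1 = -(F.adjugate * B) 0 0 := by
  rw [Matrix.trace_fin_two] at h
  linear_combination h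

/-- The map `Z ↦ F Z F*` commutes with the adjoint, so a kernel vector for `C = F⁻¹B` would be one
for the differential of `f`. -/
lemma normSq_adjugate_mul_ne (hF : F.det = 1) (hB : B.det = 0)
    (htr : (F.adjugate * B).trace = 0)
    (hreg : ∀ d : ℂ, d • (B * matE3 * Fᴴ) + conj d • (B * matE3 * Fᴴ)ᴴ = 0 → d = 0) :
    Complex.normSq ((F.adjugate * B) 0 1) ≠ Complex.normSq ((F.adjugate * B) 1 0) := by
  refine normSq_ne_of_regular (apply_one_one_of_trace htr) (by simp [hB]) fun d hd => hreg d ?_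
  have : d • (B * matE3 * Fᴴ) + conj d • (B * matE3 * Fᴴ)ᴴ =
      F * (d • (F.adjugate * B * matE3) + conj d • (F.adjugate * B * matE3)ᴴ) * Fᴴ := by
    rw [sesq_eq_conj hF]
    simp only [Matrix.mul_add, Matrix.add_mul, Matrix.mul_smul, Matrix.smul_mul,
      Matrix.conjTranspose_mul, Matrix.conjTranspose_conjTranspose, Matrix.mul_assoc]
  rw [this, hd, Matrix.mul_zero, Matrix.zero_mul]

lemma det_smul_add_smul_conjTranspose (hF : F.det = 1) (α γ : ℂ) :
    (α • (B * matE3 * Fᴴ) + γ • (B * matE3 * Fᴴ)ᴴ).det =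
      (α • (F.adjugate * B * matE3) + γ • (F.adjugate * B * matE3)ᴴ).det := by
  have : α • (B * matE3 * Fᴴ) + γ • (B * matE3 * Fᴴ)ᴴ =
      F * (α • (F.adjugate * B * matE3) + γ • (F.adjugate * B * matE3)ᴴ) * Fᴴ := by
    rw [sesq_eq_conj hF]
    simp only [Matrix.mul_add, Matrix.add_mul, Matrix.mul_smul, Matrix.smul_mul,
      Matrix.conjTranspose_mul, Matrix.conjTranspose_conjTranspose, Matrix.mul_assoc]
  rw [this, Matrix.det_mul, Matrix.det_mul, Matrix.det_conjTranspose, hF]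
  simp

/-- With `A = K'` this expresses `f_{zz̄}` through `f` and its first derivatives alone, which allows
comparison with another lift. -/
lemma sesq_self_eq (hK : K.det = 1) :
    A * matE3 * Aᴴ = (A * matE3 * Kᴴ) * (K * matE3 * Kᴴ)⁻¹ * (A * matE3 * Kᴴ)ᴴ := by
  have hKu : IsUnit K.det := by simp [hK]
  have hKu' : IsUnit Kᴴ.det := by simp [Matrix.det_conjTranspose, hK]
  have he : matE3⁻¹ = matE3 := Matrix.inv_eq_left_inv matE3_mul_self
  rw [Matrix.mul_inv_rev, Matrix.mul_inv_rev, he]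
  simp only [Matrix.conjTranspose_mul, Matrix.conjTranspose_conjTranspose, conjTranspose_matE3]
  have h1 : A * matE3 * Kᴴ * (Kᴴ⁻¹ * (matE3 * K⁻¹)) * (K * (matE3 * Aᴴ)) =
      A * matE3 * (Kᴴ * Kᴴ⁻¹) * matE3 * (K⁻¹ * K) * (matE3 * Aᴴ) := by
    simp only [Matrix.mul_assoc]
  rw [h1, Matrix.mul_nonsing_inv _ hKu', Matrix.nonsing_inv_mul _ hKu]
  rw [Matrix.mul_one, Matrix.mul_one, Matrix.mul_assoc A matE3 matE3, matE3_mul_self,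
    Matrix.mul_one, Matrix.mul_assoc]

lemma normSq_eq_of_antiholomorphic (hF : F.det = 1) (hK : K.det = 1) {c : ℂ} (hc : c ≠ 0)
    (h0 : K * matE3 * Kᴴ = F * matE3 * Fᴴ)
    (h1 : A * matE3 * Kᴴ = F * matE3 * (c • B)ᴴ)
    (h2 : A * matE3 * Aᴴ = (c • B) * matE3 * (c • B)ᴴ) :
    Complex.normSq ((F.adjugate * B) 0 1) = Complex.normSq ((F.adjugate * B) 1 0) := by
  apply normSq_eq_of_mul_eq
  set C := F.adjugate * B with hC
  have hFC : F * C = B := mul_adjugate_mul_of_det_eq_one hF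
  have hFu : IsUnit F.det := by simp [hF]
  have hFu' : IsUnit Fᴴ.det := by simp [Matrix.det_conjTranspose, hF]
  have he : matE3⁻¹ = matE3 := Matrix.inv_eq_left_inv matE3_mul_self
  rw [sesq_self_eq hK, h1, h0, ← hFC, Matrix.mul_inv_rev, Matrix.mul_inv_rev, he] at h2
  simp only [Matrix.conjTranspose_mul, Matrix.conjTranspose_conjTranspose, conjTranspose_matE3,
    Matrix.conjTranspose_smul, Matrix.smul_mul, Matrix.mul_smul, smul_smul] at h2
  rw [star_star, mul_comm c] at h2
  have hcc : star c * c ≠ 0 := mul_ne_zero (star_ne_zero.2 hc) hc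
  have h3 := smul_right_injective _ hcc h2
  have h4 : F * matE3 * (Cᴴ * Fᴴ) * (Fᴴ⁻¹ * (matE3 * F⁻¹)) * (F * C * (matE3 * Fᴴ)) =
      F * (matE3 * Cᴴ * (Fᴴ * Fᴴ⁻¹) * matE3 * (F⁻¹ * F) * C * matE3) * Fᴴ := by
    simp only [Matrix.mul_assoc]
  have h5 : F * C * matE3 * (Cᴴ * Fᴴ) = F * (C * matE3 * Cᴴ) * Fᴴ := by
    simp only [Matrix.mul_assoc]
  -- The scalar `|c|²` is already cancelled; what remains is to strip the outer `F` and `F*`.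
  rw [h4, h5, Matrix.mul_nonsing_inv _ hFu', Matrix.nonsing_inv_mul _ hFu] at h3
  have h6 := congrArg (fun Z => F⁻¹ * (Z * Fᴴ⁻¹)) h3
  simp only [Matrix.mul_nonsing_inv_cancel_right _ _ hFu',
    Matrix.nonsing_inv_mul_cancel_left _ _ hFu, Matrix.mul_one] at h6
  rw [← h6]
  simp only [Matrix.conjTranspose_mul, conjTranspose_matE3, Matrix.mul_assoc]

end Algebra

/-! ### The local contradiction -/

/-- A change of parameters between two null holomorphic lifts of the same regular surface cannot
reverse the orientation on a nonempty open set. -/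
theorem false_of_orientation_reversing {U V : Set ℂ} (hU : IsOpen U) (hV : IsOpen V)
    {K F : ℂ → Matrix (Fin 2) (Fin 2) ℂ} {T : ℂ → ℂ}
    (hK : ∀ i j, DifferentiableOn ℂ (fun x => K x i j) U) (hKdet : ∀ x ∈ U, (K x).det = 1)
    (hKnull : ∀ x ∈ U, (entryDeriv K x).det = 0)
    (hF : ∀ i j, DifferentiableOn ℂ (fun x => F x i j) V) (hFdet : ∀ x ∈ V, (F x).det = 1)
    (hFnull : ∀ x ∈ V, (entryDeriv F x).det = 0)
    (hT : DifferentiableOn ℝ T U) (hUV : Set.MapsTo T U V)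
    (heq : ∀ x ∈ U, K x * matE3 * (K x)ᴴ = F (T x) * matE3 * (F (T x))ᴴ)
    (hreg : ∀ x ∈ U, ∀ d : ℂ, d • (entryDeriv F (T x) * matE3 * (F (T x))ᴴ) +
      conj d • (entryDeriv F (T x) * matE3 * (F (T x))ᴴ)ᴴ = 0 → d = 0)
    (hneg : ∀ x ∈ U, (fderiv ℝ T x).det < 0) {v : ℂ} (hv : v ∈ U) : False := by
  have hFat : ∀ x ∈ U, ∀ i j, DifferentiableAt ℂ (fun x => F x i j) (T x) := fun x hx i j =>
    (hF i j).differentiableAt (hV.mem_nhds (hUV hx))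
  have hne : ∀ x ∈ U, Complex.normSq (((F (T x)).adjugate * entryDeriv F (T x)) 0 1) ≠
      Complex.normSq (((F (T x)).adjugate * entryDeriv F (T x)) 1 0) := fun x hx =>
    normSq_adjugate_mul_ne (hFdet _ (hUV hx)) (hFnull _ (hUV hx))
      (trace_adjugate_mul_entryDeriv (hFat x hx)
        (Filter.mem_of_superset (hV.mem_nhds (hUV hx)) hFdet)) (hreg x hx)
  have hanti : ∀ x ∈ U, ∃ β, β ≠ 0 ∧ HasWirtingerAt T 0 β x := fun x hx => by
    have hTx := (hT.differentiableAt (hU.mem_nhds hx)).hasFDerivAt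
    obtain ⟨α, β, hαβ⟩ := exists_eq_wirtingerMap (fderiv ℝ T x)
    have hn := hneg x hx
    rw [hαβ] at hTx
    rw [hαβ, det_wirtingerMap] at hn
    have hβ : β ≠ 0 := by
      rintro rfl
      have := Complex.normSq_nonneg α
      simp at hn
      linarith
    refine ⟨β, hβ, ?_⟩
    have hc := wirtinger_chain (fun i j => (hK i j).differentiableAt (hU.mem_nhds hx))
      (hFat x hx) hTx (Filter.mem_of_superset (hU.mem_nhds hx) heq)
    -- Nullity of `K` enters here; with `hc` it gives `α = 0` or `conj β = 0`, and the negative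
    -- Jacobian excludes the latter.
    have hd : (entryDeriv K x * matE3 * (K x)ᴴ).det = 0 := by
      rw [Matrix.det_mul, Matrix.det_mul, hKnull x hx, zero_mul, zero_mul]
    rw [hc, det_smul_add_smul_conjTranspose (hFdet _ (hUV hx))] at hd
    rcases mul_eq_zero_of_det_eq_zero (apply_one_one_of_trace
      (trace_adjugate_mul_entryDeriv (hFat x hx)
        (Filter.mem_of_superset (hV.mem_nhds (hUV hx)) hFdet)))
      (by rw [Matrix.det_mul, hFnull _ (hUV hx), mul_zero]) (hne x hx) hd with h | h
    · rw [← h]; exact hTx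
    · exact absurd (by simpa using h) hβ
  -- `F ∘ T` is antiholomorphic, so its entrywise conjugate is holomorphic.
  let N : ℂ → Matrix (Fin 2) (Fin 2) ℂ := fun x => (F (T x)).map conj
  have hN : ∀ x ∈ U, ∀ β, HasWirtingerAt T 0 β x → ∀ i j,
      HasDerivAt (fun x => N x i j) (conj (β * entryDeriv F (T x) i j)) x := fun x hx β hβ i j => by
    have h := ((HasWirtingerAt.of_hasDerivAt (hFat x hx i j).hasDerivAt).comp hβ).star
    apply HasWirtingerAt.hasDerivAt
    convert h using 1 <;> first | rfl | simp [entryDeriv, mul_comm]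
  have hNN : ∀ x, (N x).map conj = F (T x) := fun x => by ext i j; simp [N]
  obtain ⟨β, hβ, hTv⟩ := hanti v hv
  have hN' : (entryDeriv N v).map conj = β • entryDeriv F (T v) := by
    ext i j
    simp only [Matrix.map_apply, Matrix.smul_apply, smul_eq_mul]
    rw [show entryDeriv N v i j = _ from (hN v hv β hTv i j).deriv, Complex.conj_conj]
  obtain ⟨h1, h2⟩ := matE3_eq_of_antiholomorphic (N := N) hU hK
    (fun i j x hx => by
      obtain ⟨β, -, hβ⟩ := hanti x hx
      exact (hN x hx β hβ i j).differentiableAt.differentiableWithinAt)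
    (fun x hx => by rw [hNN, heq x hx])
  have h1 := h1 v hv
  have h2 := h2 v hv
  rw [hN', hNN] at h1
  rw [hN'] at h2
  exact hne v hv (normSq_eq_of_antiholomorphic (hFdet _ (hUV hv)) (hKdet v hv) hβ (heq v hv) h1 h2)

/-! ### From the surface to complex coordinates -/

/-- The entries of `hermMatrix`, as continuous linear maps. -/
noncomputable def hermEntry (i j : Fin 2) : (Fin 4 → ℝ) →L[ℝ] ℂ :=
  LinearMap.toContinuousLinearMap
    { toFun := fun x => hermMatrix x i j
      map_add' := fun x y => by
        fin_cases i <;> fin_cases j <;> simp [hermMatrix] <;> ring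
      map_smul' := fun c x => by
        fin_cases i <;> fin_cases j <;> simp [hermMatrix] <;> ring }

@[simp] lemma hermEntry_apply (i j : Fin 2) (x : Fin 4 → ℝ) :
    hermEntry i j x = hermMatrix x i j := rfl

lemma eq_zero_of_hermMatrix_eq_zero {x : Fin 4 → ℝ} (h : hermMatrix x = 0) : x = 0 := by
  have h00 := congrFun (congrFun h 0) 0
  have h01 := congrFun (congrFun h 0) 1
  have h11 := congrFun (congrFun h 1) 1
  simp [hermMatrix, Complex.ext_iff] at h00 h01 h11
  ext k
  fin_cases k <;> simp <;> linarith

section Surface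

variable {M : Type*} [TopologicalSpace M] [ChartedSpace (EuclideanSpace ℝ (Fin 2)) M]

/-- `z` is a complex coordinate on whose domain `f` has a null holomorphic lift. -/
def HasNullLift (f : M → Fin 4 → ℝ) (z : OpenPartialHomeomorph M ℂ) : Prop :=
  IsComplexCoordinate z ∧
    ∃ F : M → Matrix.SpecialLinearGroup (Fin 2) ℂ, IsNullHolomorphicImmersion z F ∧
      ∀ q ∈ z.source, hermMatrix (f q) =
        (F q : Matrix (Fin 2) (Fin 2) ℂ) * matE3 * (F q : Matrix (Fin 2) (Fin 2) ℂ)ᴴ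

namespace IsComplexCoordinate

variable {z w : OpenPartialHomeomorph M ℂ}

lemma contDiffOn_transition (hz : IsComplexCoordinate z) (hw : IsComplexCoordinate w) :
    ContDiffOn ℝ ∞ (w.symm.trans z) (w.symm.trans z).source := by
  rw [← contMDiffOn_iff_contDiffOn]
  refine ContMDiffOn.comp (g := z) (f := w.symm) (t := z.source) hz.1 (hw.2.mono ?_) ?_
  · exact fun x hx => hx.1
  · exact fun x hx => hx.2

lemma hasFDerivAt_transition (hz : IsComplexCoordinate z) (hw : IsComplexCoordinate w) {x : ℂ}
    (hx : x ∈ (w.symm.trans z).source) :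
    HasFDerivAt (w.symm.trans z) (fderiv ℝ (w.symm.trans z) x) x :=
  (((contDiffOn_transition hz hw).contDiffAt
    ((w.symm.trans z).open_source.mem_nhds hx)).differentiableAt (by simp)).hasFDerivAt

/-- By the chain rule, the derivative of the reverse transition is a left inverse. -/
lemma det_fderiv_transition_ne_zero (hz : IsComplexCoordinate z) (hw : IsComplexCoordinate w)
    {x : ℂ} (hx : x ∈ (w.symm.trans z).source) :
    (fderiv ℝ (w.symm.trans z) x).det ≠ 0 := by
  have hx' : (w.symm.trans z) x ∈ (z.symm.trans w).source := by
    simp only [OpenPartialHomeomorph.trans_source, OpenPartialHomeomorph.symm_source,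
      Set.mem_inter_iff, Set.mem_preimage, OpenPartialHomeomorph.coe_trans,
      Function.comp_apply] at hx ⊢
    refine ⟨z.map_source hx.2, ?_⟩
    rw [z.left_inv hx.2]
    exact w.map_target hx.1
  have h := (hasFDerivAt_transition hw hz hx').comp x (hasFDerivAt_transition hz hw hx)
  have h' : HasFDerivAt (fun y : ℂ => y) _ x := h.congr_of_eventuallyEq (by
    filter_upwards [(w.symm.trans z).open_source.mem_nhds hx] with y hy
    simp only [OpenPartialHomeomorph.trans_source, OpenPartialHomeomorph.symm_source,
      Set.mem_inter_iff, Set.mem_preimage] at hy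
    simp [z.left_inv hy.2, w.right_inv hy.1])
  have h1 := congrArg ContinuousLinearMap.det (h'.unique (hasFDerivAt_id x))
  intro h0
  have h2 : ((fderiv ℝ (z.symm.trans w) ((w.symm.trans z) x)).comp
      (fderiv ℝ (w.symm.trans z) x)).det = _ * (fderiv ℝ (w.symm.trans z) x).det :=
    LinearMap.det_comp _ _
  rw [h2, h0, mul_zero] at h1
  simp [ContinuousLinearMap.det] at h1

end IsComplexCoordinate

/-- At a regular point, the differential of `F e₃ F*` in the complex coordinate is injective. -/
lemma eq_zero_of_mem_regularSet {f : M → Fin 4 → ℝ} (hf : ContMDiff (𝓡 2) 𝓘(ℝ, Fin 4 → ℝ) ∞ f)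
    {z : OpenPartialHomeomorph M ℂ} (hz : IsComplexCoordinate z)
    {F : ℂ → Matrix (Fin 2) (Fin 2) ℂ}
    (hF : ∀ i j, DifferentiableOn ℂ (fun x => F x i j) z.target)
    (heq : ∀ x ∈ z.target, hermMatrix (f (z.symm x)) = F x * matE3 * (F x)ᴴ)
    {x : ℂ} (hx : x ∈ z.target) (hreg : z.symm x ∈ regularSet f) {d : ℂ}
    (hd : d • (entryDeriv F x * matE3 * (F x)ᴴ) +
      conj d • (entryDeriv F x * matE3 * (F x)ᴴ)ᴴ = 0) : d = 0 := by
  have hzs : MDifferentiableAt 𝓘(ℝ, ℂ) (𝓡 2) z.symm x :=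
    (hz.2.contMDiffAt (z.open_target.mem_nhds hx)).mdifferentiableAt (by simp)
  have hzx : MDifferentiableAt (𝓡 2) 𝓘(ℝ, ℂ) z (z.symm x) :=
    (hz.1.contMDiffAt (z.open_source.mem_nhds (z.map_target hx))).mdifferentiableAt (by simp)
  have hfx : MDifferentiableAt (𝓡 2) 𝓘(ℝ, Fin 4 → ℝ) f (z.symm x) :=
    hf.mdifferentiable (by simp) _
  let A : ℂ →L[ℝ] EuclideanSpace ℝ (Fin 2) := mfderiv 𝓘(ℝ, ℂ) (𝓡 2) z.symm x
  let B : EuclideanSpace ℝ (Fin 2) →L[ℝ] ℂ := mfderiv (𝓡 2) 𝓘(ℝ, ℂ) z (z.symm x)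
  let D : EuclideanSpace ℝ (Fin 2) →L[ℝ] (Fin 4 → ℝ) :=
    mfderiv (𝓡 2) 𝓘(ℝ, Fin 4 → ℝ) f (z.symm x)
  have hφ : HasFDerivAt (fun y => f (z.symm y)) (D.comp A) x :=
    (hfx.hasMFDerivAt.comp x hzs.hasMFDerivAt).hasFDerivAt
  have hid : HasFDerivAt (fun y => z (z.symm y)) (B.comp A) x :=
    (hzx.hasMFDerivAt.comp x hzs.hasMFDerivAt).hasFDerivAt
  have hid' := (hid.congr_of_eventuallyEq (f₁ := fun y : ℂ => y) (by
    filter_upwards [z.open_target.mem_nhds hx] with y hy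
    exact (z.right_inv hy).symm)).unique (hasFDerivAt_id x)
  have hF' : ∀ i j, HasWirtingerAt (fun x => F x i j) (entryDeriv F x i j)
      ((0 : Matrix (Fin 2) (Fin 2) ℂ) i j) x := fun i j =>
    HasWirtingerAt.of_hasDerivAt ((hF i j).differentiableAt (z.open_target.mem_nhds hx)).hasDerivAt
  -- The Hermitian matrix of `D (A d)` is the left-hand side of `hd`.
  have hzero : D (A d) = 0 := by
    refine eq_zero_of_hermMatrix_eq_zero ?_
    ext i j
    have h1 := (hermEntry i j).hasFDerivAt.comp x hφ
    have h2 : HasFDerivAt (fun y => hermEntry i j (f (z.symm y))) _ x :=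
      (HasWirtingerAt.matE3 hF' hF' i j).congr_of_eventuallyEq (by
        filter_upwards [z.open_target.mem_nhds hx] with y hy
        rw [hermEntry_apply, heq y hy])
    have h3 := congrArg (fun L : ℂ →L[ℝ] ℂ => L d) (h1.unique h2)
    refine h3.trans ?_
    have h4 := congrFun (congrFun hd i) j
    simp only [Matrix.conjTranspose_mul, Matrix.conjTranspose_conjTranspose, conjTranspose_matE3,
      Matrix.add_apply, Matrix.smul_apply, smul_eq_mul, Matrix.zero_apply,
      Matrix.mul_assoc] at h4
    simp only [wirtingerMap_apply, Matrix.conjTranspose_zero, mul_zero, add_zero, Matrix.zero_mul,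
      zero_add, Matrix.mul_assoc, Matrix.zero_apply]
    linear_combination h4
  have h0 : A d = 0 := hreg (hzero.trans (map_zero D).symm)
  have h5 : B (A d) = d := congrArg (fun L : ℂ →L[ℝ] ℂ => L d) hid'
  rw [← h5, h0, map_zero]

/-- Complex coordinates that carry null lifts of one CMC-1 face induce the same orientation. -/
lemma HasNullLift.det_fderiv_transition_pos {f : M → Fin 4 → ℝ} (hf : IsCMCOneFace f)
    {z w : OpenPartialHomeomorph M ℂ} (hz : HasNullLift f z) (hw : HasNullLift f w) {x : ℂ}
    (hx : x ∈ (w.symm.trans z).source) : 0 < (fderiv ℝ (w.symm.trans z) x).det := by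
  obtain ⟨hz, F, hF, hFeq⟩ := hz
  obtain ⟨hw, K, hK, hKeq⟩ := hw
  by_contra hcon
  have hneg : (fderiv ℝ (w.symm.trans z) x).det < 0 :=
    lt_of_le_of_ne (not_lt.1 hcon) (hz.det_fderiv_transition_ne_zero hw hx)
  set S := (w.symm.trans z).source with hS
  have hSo : IsOpen S := (w.symm.trans z).open_source
  have hST : ∀ y ∈ S, y ∈ w.target ∧ w.symm y ∈ z.source := fun y hy => by
    simpa [hS] using hy
  have hTs := hz.contDiffOn_transition hw
  have hcont : ContinuousOn (fun y => (fderiv ℝ (w.symm.trans z) y).det) S :=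
    ContinuousLinearMap.continuous_det.comp_continuousOn
      (hTs.continuousOn_fderiv_of_isOpen hSo (by simp))
  set U₀ := S ∩ (fun y => (fderiv ℝ (w.symm.trans z) y).det) ⁻¹' Set.Iio 0 with hU₀
  have hU₀o : IsOpen U₀ := hcont.isOpen_inter_preimage hSo isOpen_Iio
  have hU₀t : U₀ ⊆ w.target := fun y hy => (hST y hy.1).1
  -- The given point may be singular; density supplies a regular one where the Jacobian is still
  -- negative.
  obtain ⟨p, ⟨y, hy, rfl⟩, hp⟩ := hf.dense_regularSet.inter_open_nonempty _
    (w.symm.isOpen_image_of_subset_source hU₀o hU₀t) ⟨_, x, ⟨hx, hneg⟩, rfl⟩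
  set U := U₀ ∩ w.symm ⁻¹' regularSet f with hU
  have hUo : IsOpen U :=
    (w.continuousOn_symm.mono hU₀t).isOpen_inter_preimage hU₀o hf.isOpen_regularSet
  have hUt : U ⊆ w.target := fun y hy => hU₀t hy.1
  have hUS : U ⊆ S := fun y hy => hy.1.1
  refine false_of_orientation_reversing (U := U) (V := z.target)
    (K := fun y => K (w.symm y)) (F := fun y => F (z.symm y)) (T := w.symm.trans z)
    hUo z.open_target (fun i j => (hK.holomorphic i j).mono hUt) (fun y _ => (K _).2)
    (fun y hy => hK.null y (hUt hy)) hF.holomorphic (fun y _ => (F _).2) hF.null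
    ((hTs.differentiableOn (by simp)).mono hUS) (fun y hy => z.map_source (hST y (hUS hy)).2)
    (fun y hy => ?_) (fun y hy d hd => ?_) (fun y hy => hy.1.2) ⟨hy, hp⟩
  · obtain ⟨h1, h2⟩ := hST y (hUS hy)
    have h3 : z.symm ((w.symm.trans z) y) = w.symm y := z.left_inv h2
    simp only [h3]
    rw [← hFeq _ h2, ← hKeq _ (w.map_target h1)]
  · have h2 := (hST y (hUS hy)).2
    have h3 : z.symm ((w.symm.trans z) y) = w.symm y := z.left_inv h2
    have hr : z.symm ((w.symm.trans z) y) ∈ regularSet f := by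
      rw [h3]
      exact hy.2
    exact eq_zero_of_mem_regularSet hf.smooth hz (F := fun y => F (z.symm y)) hF.holomorphic
      (fun y hy => hFeq _ (z.map_target hy)) (z.map_source h2) hr hd

/-! ### The oriented atlas -/

/-- The identification of `ℂ` with the Euclidean plane. -/
noncomputable def complexEquivPlane : ℂ ≃L[ℝ] EuclideanSpace ℝ (Fin 2) :=
  Complex.orthonormalBasisOneI.repr.toContinuousLinearEquiv

/-- A complex coordinate as a chart with values in the Euclidean plane. -/
noncomputable def planeChart (z : OpenPartialHomeomorph M ℂ) :
    OpenPartialHomeomorph M (EuclideanSpace ℝ (Fin 2)) :=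
  z.transHomeomorph complexEquivPlane.toHomeomorph

lemma IsComplexCoordinate.planeChart_mem_maximalAtlas [IsManifold (𝓡 2) ∞ M]
    {z : OpenPartialHomeomorph M ℂ}
    (hz : IsComplexCoordinate z) : planeChart z ∈ IsManifold.maximalAtlas (𝓡 2) ∞ M := by
  refine (planeChart z).mem_maximalAtlas_of_contMDiffOn ?_ ?_
  · exact complexEquivPlane.contDiff.contMDiff.comp_contMDiffOn hz.1
  · exact hz.2.comp complexEquivPlane.symm.contDiff.contMDiff.contMDiffOn fun x hx => hx

lemma HasNullLift.det_fderiv_planeChart_pos {f : M → Fin 4 → ℝ} (hf : IsCMCOneFace f)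
    {z w : OpenPartialHomeomorph M ℂ} (hz : HasNullLift f z) (hw : HasNullLift f w)
    {x : EuclideanSpace ℝ (Fin 2)} (hx : x ∈ ((planeChart w).symm.trans (planeChart z)).source) :
    0 < (fderiv ℝ ((planeChart w).symm.trans (planeChart z)) x).det := by
  have hx' : complexEquivPlane.symm x ∈ (w.symm.trans z).source := hx
  have h := complexEquivPlane.hasFDerivAt.comp x
    ((hz.1.hasFDerivAt_transition hw.1 hx').comp x
      complexEquivPlane.symm.hasFDerivAt)
  have h' : HasFDerivAt ((planeChart w).symm.trans (planeChart z)) _ x := h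
  rw [h'.fderiv]
  -- Both charts use the same identification with the plane, so the Jacobian is only conjugated.
  have hdet := LinearMap.det_conj (fderiv ℝ (w.symm.trans z) (complexEquivPlane.symm x) : ℂ →ₗ[ℝ] ℂ)
    complexEquivPlane.toLinearEquiv
  exact (hz.det_fderiv_transition_pos hf hw hx').trans_eq hdet.symm

end Surface

theorem theorem4p1 {M : Type*} [TopologicalSpace M] [T2Space M] [SecondCountableTopology M]
    [ConnectedSpace M] [ChartedSpace (EuclideanSpace ℝ (Fin 2)) M] [IsManifold (𝓡 2) ∞ M]
    (f : M → Fin 4 → ℝ) (hf : IsCMCOneFace f) : IsOrientableSurface M := by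
  refine ⟨planeChart '' {z | HasNullLift f z}, ?_, fun p => ?_, ?_⟩
  · rintro _ ⟨z, hz, rfl⟩
    exact hz.1.planeChart_mem_maximalAtlas
  · obtain ⟨z, hp, hz⟩ := hf.exists_lift p
    exact ⟨planeChart z, ⟨z, hz, rfl⟩, hp⟩
  · rintro _ ⟨w, hw, rfl⟩ _ ⟨z, hz, rfl⟩ x hx
    exact HasNullLift.det_fderiv_planeChart_pos hf hz hw hx
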